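/- Let $(M,Q)$ be a pair of real random variables with $M>0$ almost surely and $\mathbf P(M\neq 1)>0$, and suppose that for some $\beta>0$ $$\mathbf E M^\beta=1,\qquad \mathbf E\,M^\beta(\ln M)^+<\infty,\qquad \mathbf E|Q|^\beta<\infty .$$ Suppose that, for some $d>0$, the distribution of $\ln M$ is concentrated on the lattice $\mathbb Z d$. Let $Y_\infty$ be a real random variable, independent of $(M,Q)$, that solves the distributional equation $Y_\infty\stackrel{d}{=}Q+M\,Y_\infty$. Then $$\limsup_{u\to\infty}u^\beta\,\mathbf P(Y_\infty>u)<\infty .$$ -/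

import Mathlib

open MeasureTheory ProbabilityTheory Filter
open scoped ENNReal

/-- `Y` solves the affine distributional equation `Y =ᵈ Q + M * Y`, with `Y` independent of the
pair `(M, Q)`, all random variables being realized on the probability space `(Ω, P)`. -/
structure SolvesAffineEquation {Ω : Type*} [MeasurableSpace Ω] (P : Measure Ω)
    (M Q Y : Ω → ℝ) : Prop where
  indep : IndepFun Y (fun ω => (M ω, Q ω)) P
  law_eq : IdentDistrib Y (fun ω => Q ω + M ω * Y ω) P P

/-! Put $L=e^{\beta d}$ and $f(n)=\int_{L^n}^{L^{n+1}}\mathbf P((Y^+)^\beta>t)\,dt$, which controls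
$u^\beta\mathbf P(Y>u)$ for $u^\beta$ of order $L^n$. On the lattice, multiplying $Y$ by $e^{kd}$
sends $f(n)$ to $L^k f(n-k)$. Averaging over $M$ is therefore convolution with $p_k=\mathbf
P(M=e^{kd})L^k$, a probability on $\mathbb Z$ because $\mathbf E M^\beta=1$. Replacing $Q+MY$ by
$MY$ gives $f\le p*f+g$, where $\sum g\le\mathbf E\bigl(((Q+MY)^+)^\beta-((MY)^+)^\beta\bigr)^+$.

This sum is finite because the increment involves only powers $|Y|^\theta$ with $\theta<\beta$
(`exists_posPart_rpow_add_le`). Strict concavity gives $\mathbf E M^\theta<1$, and a drift argument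
then gives $\mathbf E|Y|^\theta<\infty$.

Boundedness of $f$ needs only transience, not a renewal theorem (`exists_bound_of_le_intConv_add`).
With $c=e^{(\beta-\theta)d}$, the function $c^n$ is an eigenfunction of $p*\cdot$ with eigenvalue
$\rho=\mathbf E M^\theta<1$. It bounds the Green function at $0$ by $(1-\rho)^{-1}$, and the maximum
principle extends this to all of $\mathbb Z$. Since $f\le C c^n$, the iterates of $f$ vanish and
$f\le(1-\rho)^{-1}\sum g$. -/

/-! ### Renewal inequalities on the integers. -/

/-- Convolution of `u` with the weights `p` on `ℤ`. -/
noncomputable def intConv (p u : ℤ → ℝ≥0∞) (n : ℤ) : ℝ≥0∞ := ∑' k, p k * u (n - k)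

theorem intConv_mono (p : ℤ → ℝ≥0∞) {u v : ℤ → ℝ≥0∞} (h : u ≤ v) : intConv p u ≤ intConv p v :=
  fun n => ENNReal.tsum_le_tsum fun k => mul_le_mul_right (h (n - k)) _

theorem intConv_add (p u v : ℤ → ℝ≥0∞) : intConv p (u + v) = intConv p u + intConv p v := by
  ext n
  simp [intConv, mul_add, ENNReal.tsum_add]

theorem intConv_smul (p u : ℤ → ℝ≥0∞) (a : ℝ≥0∞) :
    intConv p (a • u) = a • intConv p u := by
  ext n
  simp only [intConv, Pi.smul_apply, smul_eq_mul, ← ENNReal.tsum_mul_left]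
  exact tsum_congr fun k => by ring

theorem tsum_intConv (p u : ℤ → ℝ≥0∞) : ∑' n, intConv p u n = (∑' k, p k) * ∑' n, u n := by
  unfold intConv
  rw [ENNReal.tsum_comm, ← ENNReal.tsum_mul_right]
  refine tsum_congr fun k => ?_
  rw [ENNReal.tsum_mul_left]
  congr 1
  exact (Equiv.subRight k).tsum_eq u

theorem iterate_intConv_mono (p : ℤ → ℝ≥0∞) {u v : ℤ → ℝ≥0∞} (h : u ≤ v) (i : ℕ) :
    (intConv p)^[i] u ≤ (intConv p)^[i] v :=
  (show Monotone (intConv p) from fun _ _ h => intConv_mono p h).iterate i h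

theorem tsum_iterate_intConv {p : ℤ → ℝ≥0∞} (hp : ∑' k, p k = 1) (u : ℤ → ℝ≥0∞) (i : ℕ) :
    ∑' n, (intConv p)^[i] u n = ∑' n, u n := by
  induction i with
  | zero => rfl
  | succ i ih => rw [Function.iterate_succ_apply', tsum_intConv, hp, one_mul, ih]

theorem iterate_intConv_eigen {p h : ℤ → ℝ≥0∞} {ρ : ℝ≥0∞} (hh : intConv p h = ρ • h) (i : ℕ) :
    (intConv p)^[i] h = ρ ^ i • h := by
  induction i with
  | zero => simp
  | succ i ih => rw [Function.iterate_succ_apply', ih, intConv_smul, hh, smul_smul, pow_succ]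

/-- By linearity and translation invariance, a uniform bound on the kernel started at a point mass
passes to every summable source. -/
theorem iterate_intConv_eq_tsum (p g : ℤ → ℝ≥0∞) (i : ℕ) (n : ℤ) :
    (intConv p)^[i] g n = ∑' m, g m * (intConv p)^[i] (Pi.single 0 1) (n - m) := by
  induction i generalizing n with
  | zero =>
    rw [tsum_eq_single n]
    · simp
    · intro m hm
      have : n - m ≠ 0 := sub_ne_zero.2 hm.symm
      simp [this]
  | succ i ih =>
    simp only [Function.iterate_succ_apply']
    conv_lhs => rw [intConv]
    simp only [ih, ← ENNReal.tsum_mul_left]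
    rw [ENNReal.tsum_comm]
    refine tsum_congr fun m => ?_
    rw [intConv, ← ENNReal.tsum_mul_left]
    refine tsum_congr fun k => ?_
    rw [show n - k - m = n - m - k by ring]
    ring

theorem intConv_lt_of_lt {p : ℤ → ℝ≥0∞} (hp : ∑' k, p k = 1) {u : ℤ → ℝ≥0∞} {s : ℝ≥0∞}
    (hs : s ≠ ∞) (hu : ∀ n, u n ≤ s) {j : ℤ} (hj : p j ≠ 0) {n : ℤ} (h : u (n - j) < s) :
    intConv p u n < s := by
  have hle : ∀ k, p k * u (n - k) ≤ p k * s := fun k => mul_le_mul_right (hu _) _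
  have htot : ∑' k, p k * s = s := by rw [ENNReal.tsum_mul_right, hp, one_mul]
  have hpj : p j ≠ ∞ := ((hp ▸ ENNReal.le_tsum j : p j ≤ 1).trans_lt ENNReal.one_lt_top).ne
  calc intConv p u n < ∑' k, p k * s := by
        refine ENNReal.tsum_lt_tsum (i := j) ?_ hle ?_
        · exact ((ENNReal.tsum_le_tsum hle).trans_lt (htot.trans_lt hs.lt_top)).ne
        · exact ENNReal.mul_lt_mul_right hj hpj h
    _ = s := htot

/-- Maximum principle: a summable function that is subharmonic off the origin is largest there. -/
theorem le_apply_zero_of_le_intConv {p : ℤ → ℝ≥0∞} (hp : ∑' k, p k = 1) {j : ℤ} (hj0 : j ≠ 0)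
    (hj : p j ≠ 0) {u : ℤ → ℝ≥0∞} (hu : ∑' n, u n ≠ ∞)
    (hsub : ∀ n ≠ 0, u n ≤ intConv p u n) (n : ℤ) : u n ≤ u 0 := by
  by_contra! hn
  have hfin : ∀ ε, ε ≠ 0 → {k | ε ≤ u k}.Finite := fun ε hε =>
    ENNReal.finite_const_le_of_tsum_ne_top hu hε
  have hun : u n ≠ 0 := (zero_le.trans_lt hn).ne'
  obtain ⟨m, hm, hmax⟩ := (hfin _ hun).exists_maximalFor u _ ⟨n, le_refl (u n)⟩
  have hle : ∀ k, u k ≤ u m := by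
    intro k
    rcases le_total (u n) (u k) with h | h
    · rcases le_total (u k) (u m) with h' | h'
      · exact h'
      · exact hmax h h'
    · exact h.trans hm
  have htop : u m ≠ ∞ := ((ENNReal.le_tsum m).trans_lt hu.lt_top).ne
  -- A maximum off the origin is inherited along the step `j`. The orbit never meets `0`, where `u`
  -- is too small, so a superlevel set is infinite, against summability.
  have hstep : ∀ i : ℕ, u (m - i * j) = u m := by
    intro i
    induction i with
    | zero => simp
    | succ i ih =>
      have hne : m - i * j ≠ 0 := by
        intro h0
        rw [h0] at ih
        exact absurd (ih ▸ hm : u n ≤ u 0) hn.not_ge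
      by_contra hcon
      have hlt : u (m - i * j - j) < u m := by
        refine lt_of_le_of_ne (hle _) ?_
        rwa [show m - i * j - j = m - ↑(i + 1) * j by push_cast; ring]
      have := intConv_lt_of_lt hp htop hle hj hlt
      exact absurd (hsub _ hne) (by rw [ih]; exact this.not_ge)
  refine (Set.infinite_range_of_injective (f := fun i : ℕ => m - i * j) ?_)
    ((hfin _ hun).subset ?_)
  · intro a b hab
    have : ((a : ℤ)) * j = b * j := by simpa using hab
    exact_mod_cast mul_right_cancel₀ hj0 this
  · rintro _ ⟨i, rfl⟩
    change u n ≤ u (m - i * j)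
    rw [hstep]; exact hm

/-- A transient renewal inequality on `ℤ` with summable inhomogeneity has bounded solutions. -/
theorem exists_bound_of_le_intConv_add {p f g : ℤ → ℝ≥0∞} {c ρ C : ℝ≥0∞}
    (hp : ∑' k, p k = 1) (hρ : ρ < 1) (hc0 : c ≠ 0) (hc : c ≠ ∞) (hpc : ∑' k, p k * c ^ (-k) = ρ)
    (hC : C ≠ ∞) (hfC : ∀ n, f n ≤ C * c ^ n) (hg : ∑' n, g n ≠ ∞)
    (hf : ∀ n, f n ≤ intConv p f n + g n) : ∃ B : ℝ≥0∞, B ≠ ∞ ∧ ∀ n, f n ≤ B := by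
  -- Otherwise `p` is the point mass at `0` and `ρ = 1`.
  obtain ⟨j, hj0, hj⟩ : ∃ j : ℤ, j ≠ 0 ∧ p j ≠ 0 := by
    by_contra! h
    rw [tsum_eq_single 0 h] at hp
    rw [tsum_eq_single 0 (fun k hk => by rw [h k hk, zero_mul]), hp] at hpc
    simp at hpc
    exact hρ.ne hpc.symm
  set h : ℤ → ℝ≥0∞ := fun n => c ^ n with hh
  have heig : intConv p h = ρ • h := by
    ext n
    simp only [intConv, hh, Pi.smul_apply, smul_eq_mul, ← hpc, ← ENNReal.tsum_mul_right]
    refine tsum_congr fun k => ?_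
    rw [sub_eq_add_neg, ENNReal.zpow_add hc0 hc]
    ring
  -- The point mass lies below the eigenfunction `h`, and `h 0 = 1`.
  have hpot : ∀ i : ℕ, (intConv p)^[i] (Pi.single 0 1) 0 ≤ ρ ^ i := by
    intro i
    have h1 : (Pi.single 0 1 : ℤ → ℝ≥0∞) ≤ h := by
      intro n
      rcases eq_or_ne n 0 with rfl | hn
      · simp [hh]
      · simp [hn]
    have h2 := iterate_intConv_mono p h1 i 0
    rw [iterate_intConv_eigen heig] at h2
    simpa [hh] using h2
  -- Partial sums of the Green function have total mass `N`, so the maximum principle applies to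
  -- them; the full series need not be summable over `ℤ`.
  have hU : ∀ (N : ℕ) (n : ℤ),
      ∑ i ∈ Finset.range N, (intConv p)^[i] (Pi.single 0 1) n ≤ (1 - ρ)⁻¹ := by
    intro N n
    set u : ℕ → ℤ → ℝ≥0∞ :=
      fun N n => ∑ i ∈ Finset.range N, (intConv p)^[i] (Pi.single 0 1) n with hu
    have hrec : ∀ N, u (N + 1) = Pi.single 0 1 + intConv p (u N) := by
      intro N
      ext n
      simp only [hu, Finset.sum_range_succ', Function.iterate_succ_apply', Pi.add_apply, intConv,
        Finset.mul_sum, Function.iterate_zero, id]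
      rw [add_comm, Summable.tsum_finsetSum fun _ _ => ENNReal.summable]
    have hsum : ∑' n, u N n ≠ ∞ := by
      simp only [hu]
      rw [Summable.tsum_finsetSum fun _ _ => ENNReal.summable]
      simp only [tsum_iterate_intConv hp, tsum_pi_single]
      simp
    have hsub : ∀ n ≠ 0, u N n ≤ intConv p (u N) n := by
      intro n hn
      have hmono : u N ≤ u (N + 1) := by
        intro n
        simp only [hu, Finset.sum_range_succ]
        exact le_self_add
      refine (hmono n).trans ?_
      rw [hrec]
      simp [hn]
    calc u N n ≤ u N 0 := le_apply_zero_of_le_intConv hp hj0 hj hsum hsub n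
      _ ≤ ∑ i ∈ Finset.range N, ρ ^ i := Finset.sum_le_sum fun i _ => hpot i
      _ ≤ ∑' i, ρ ^ i := ENNReal.sum_le_tsum _
      _ = (1 - ρ)⁻¹ := ENNReal.tsum_geometric ρ
  have hiter : ∀ N : ℕ, ∀ n, f n ≤ (intConv p)^[N] f n +
      ∑ i ∈ Finset.range N, (intConv p)^[i] g n := by
    intro N
    induction N with
    | zero => simp
    | succ N ih =>
      intro n
      refine (ih n).trans ?_
      have hadd : ∀ (i : ℕ) (u v : ℤ → ℝ≥0∞),
          (intConv p)^[i] (u + v) = (intConv p)^[i] u + (intConv p)^[i] v := by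
        intro i
        induction i with
        | zero => simp
        | succ i ih => intro u v; simp only [Function.iterate_succ_apply, intConv_add, ih]
      have h1 := iterate_intConv_mono p (show f ≤ intConv p f + g from hf) N n
      rw [hadd] at h1
      rw [Finset.sum_range_succ, Function.iterate_succ_apply, add_comm (∑ i ∈ _, _), ← add_assoc]
      gcongr
      exact h1
  have hgU : ∀ (N : ℕ) n, ∑ i ∈ Finset.range N, (intConv p)^[i] g n ≤
      (∑' m, g m) * (1 - ρ)⁻¹ := by
    intro N n
    simp only [iterate_intConv_eq_tsum p g]
    rw [← Summable.tsum_finsetSum fun _ _ => ENNReal.summable, ← ENNReal.tsum_mul_right]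
    refine ENNReal.tsum_le_tsum fun m => ?_
    rw [← Finset.mul_sum]
    exact mul_le_mul_right (hU N _) _
  refine ⟨(∑' m, g m) * (1 - ρ)⁻¹, ENNReal.mul_ne_top hg ?_, fun n => ?_⟩
  · exact ENNReal.inv_ne_top.2 (tsub_pos_of_lt hρ).ne'
  have hlim : Tendsto (fun N : ℕ => C * (ρ ^ N * h n) + (∑' m, g m) * (1 - ρ)⁻¹) atTop
      (nhds (C * (0 * h n) + (∑' m, g m) * (1 - ρ)⁻¹)) := by
    refine Tendsto.add (ENNReal.Tendsto.const_mul (ENNReal.Tendsto.mul_const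
      (ENNReal.tendsto_pow_atTop_nhds_zero_of_lt_one hρ) (Or.inr ?_)) (Or.inr hC))
      tendsto_const_nhds
    exact ENNReal.zpow_ne_top hc0 hc n
  simp only [zero_mul, mul_zero, zero_add] at hlim
  refine ge_of_tendsto' hlim fun N => (hiter N n).trans (add_le_add ?_ (hgU N n))
  have h2 := iterate_intConv_mono p (show f ≤ C • h from hfC) N n
  have hsm : intConv p (C • h) = ρ • (C • h) := by
    rw [intConv_smul, heig, smul_comm]
  rw [iterate_intConv_eigen hsm] at h2
  simpa [mul_left_comm] using h2

/-! ### Elementary power inequalities. -/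

/-- The factor on `b` must be arbitrarily close to `1`, to keep a contraction after multiplying by
`E M ^ θ < 1`; all the loss goes into `C`. -/
theorem rpow_abs_add_le {θ : ℝ} (hθ : 0 < θ) {ε : ℝ} (hε : 0 < ε) :
    ∃ C : ℝ, 0 ≤ C ∧ ∀ a b : ℝ, |a + b| ^ θ ≤ C * |a| ^ θ + (1 + ε) * |b| ^ θ := by
  set δ : ℝ := (1 + ε) ^ (θ⁻¹) - 1 with hδ
  have hδ0 : 0 < δ := by
    have := Real.one_lt_rpow (show 1 < 1 + ε by linarith) (inv_pos.2 hθ)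
    linarith
  have hδε : (1 + δ) ^ θ = 1 + ε := by
    rw [hδ, add_sub_cancel, Real.rpow_inv_rpow (by linarith) hθ.ne']
  refine ⟨(1 + δ⁻¹) ^ θ, by positivity, fun a b => ?_⟩
  rcases le_total |a| (δ * |b|) with h | h
  · calc |a + b| ^ θ ≤ ((1 + δ) * |b|) ^ θ := by
          gcongr
          linarith [abs_add_le a b]
      _ = (1 + ε) * |b| ^ θ := by rw [Real.mul_rpow (by positivity) (abs_nonneg _), hδε]
      _ ≤ _ := le_add_of_nonneg_left (by positivity)
  · calc |a + b| ^ θ ≤ ((1 + δ⁻¹) * |a|) ^ θ := by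
          gcongr
          have : |b| ≤ δ⁻¹ * |a| := by rwa [← div_eq_inv_mul, le_div_iff₀' hδ0]
          linarith [abs_add_le a b]
      _ = (1 + δ⁻¹) ^ θ * |a| ^ θ := by rw [Real.mul_rpow (by positivity) (abs_nonneg _)]
      _ ≤ _ := le_add_of_nonneg_right (by positivity)

theorem rpow_mul_rpow_le_add {x y a b s : ℝ} (hx : 0 ≤ x) (hy : 0 ≤ y) (ha : 0 ≤ a) (hb : 0 ≤ b)
    (hab : a + b = s) : x ^ a * y ^ b ≤ x ^ s + y ^ s := by
  have hm : 0 ≤ max x y := le_max_of_le_left hx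
  calc x ^ a * y ^ b ≤ max x y ^ a * max x y ^ b := by
        gcongr
        · exact le_max_left _ _
        · exact le_max_right _ _
    _ = max x y ^ s := by rw [← Real.rpow_add_of_nonneg hm ha hb, hab]
    _ ≤ x ^ s + y ^ s := by
        rcases max_cases x y with ⟨h, -⟩ | ⟨h, -⟩ <;> rw [h]
        · exact le_add_of_nonneg_right (by positivity)
        · exact le_add_of_nonneg_left (by positivity)

/-- Convexity: Bernoulli's inequality at the ratio `a / (a + b)`. -/
theorem rpow_add_sub_rpow_le {β : ℝ} (hβ : 1 ≤ β) {a b : ℝ} (ha : 0 ≤ a) (hb : 0 ≤ b) :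
    (a + b) ^ β ≤ a ^ β + β * b * (a + b) ^ (β - 1) := by
  rcases (add_nonneg ha hb).eq_or_lt with h | h
  · have ha' : a = 0 := by linarith
    have hb' : b = 0 := by linarith
    simp [ha', hb', Real.zero_rpow (by linarith : β ≠ 0)]
  · have h1 := one_add_mul_self_le_rpow_one_add (s := a / (a + b) - 1)
      (by linarith [div_nonneg ha h.le]) hβ
    rw [add_sub_cancel, Real.div_rpow ha h.le, le_div_iff₀ (by positivity)] at h1
    have h2 : (a + b) ^ β = (a + b) * (a + b) ^ (β - 1) := by
      rw [← Real.rpow_one_add' h.le (by linarith)]; congr 1; ring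
    have h3 : a / (a + b) - 1 = - b / (a + b) := by field_simp; ring
    rw [h3] at h1
    have h4 : (1 + β * (-b / (a + b))) * (a + b) ^ β =
        (a + b) ^ β - β * b * (a + b) ^ (β - 1) := by
      rw [add_mul, one_mul]
      conv_lhs => rw [h2]
      conv_rhs => rw [h2]
      field_simp
      ring
    linarith

/-- The positive-part power `y ↦ (y⁺) ^ β` has increments controlled by mixed powers. -/
theorem exists_posPart_rpow_add_le {β : ℝ} (hβ : 0 < β) :
    ∃ C θ : ℝ, 0 ≤ C ∧ 0 < θ ∧ θ < β ∧ ∀ q m y : ℝ, 0 ≤ m →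
      max (q + m * y) 0 ^ β ≤
        max (m * y) 0 ^ β + C * ((|q| ^ β + m ^ β) * (1 + |y| ^ θ)) := by
  have htriv : ∀ (θ : ℝ) (q m y : ℝ), 0 ≤ m →
      |q| ^ β ≤ (|q| ^ β + m ^ β) * (1 + |y| ^ θ) := by
    intro θ q m y hm
    have h1 : 0 ≤ |q| ^ β := by positivity
    have h2 : 0 ≤ m ^ β := by positivity
    have h3 : 0 ≤ |y| ^ θ := by positivity
    nlinarith [mul_nonneg h1 h3, mul_nonneg h2 h3]
  have hmono : ∀ q x : ℝ, x ≤ 0 ∨ q ≤ 0 → max (q + x) 0 ^ β ≤ max x 0 ^ β + |q| ^ β := by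
    rintro q x (h | h)
    · refine le_add_of_nonneg_of_le (by positivity) ?_
      gcongr
      exact max_le (by linarith [le_abs_self q]) (abs_nonneg q)
    · refine le_add_of_le_of_nonneg ?_ (by positivity)
      gcongr
      linarith
  rcases le_or_gt β 1 with h1 | h1
  -- Here `x ↦ x ^ β` is subadditive, so any `θ` in `(0, β)` would do.
  · refine ⟨1, β / 2, zero_le_one, by linarith, by linarith, fun q m y hm => ?_⟩
    rw [one_mul]
    refine le_trans ?_ (add_le_add_right (htriv (β / 2) q m y hm) _)
    by_cases h : m * y ≤ 0 ∨ q ≤ 0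
    · exact hmono _ _ h
    · push Not at h
      rw [max_eq_left (by linarith [h.1, h.2]), max_eq_left h.1.le, abs_of_pos h.2, add_comm q]
      exact Real.rpow_add_le_add_rpow h.1.le h.2.le hβ.le h1
  -- The `1` covers the cases `m * y ≤ 0` or `q ≤ 0`; the other term comes from the convexity bound,
  -- with `T` controlling both `q ^ β` and the mixed term.
  · refine ⟨1 + β * 2 ^ (β - 1) * 2, β - 1, by positivity, by linarith, by linarith,
      fun q m y hm => ?_⟩
    have hT := htriv (β - 1) q m y hm
    set T := (|q| ^ β + m ^ β) * (1 + |y| ^ (β - 1)) with hTdef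
    have hT0 : 0 ≤ T := by positivity
    by_cases h : m * y ≤ 0 ∨ q ≤ 0
    · refine (hmono _ _ h).trans (add_le_add_right (hT.trans ?_) _)
      exact le_mul_of_one_le_left hT0 (le_add_of_nonneg_right (by positivity))
    · push Not at h
      obtain ⟨hx, hq⟩ := h
      have hy : 0 < y := pos_of_mul_pos_right hx hm
      have hm0 : 0 < m := pos_of_mul_pos_left hx hy.le
      rw [max_eq_left (by linarith), max_eq_left hx.le, add_comm q]
      have h2 := rpow_add_sub_rpow_le h1.le hx.le hq.le
      have h3 : (m * y + q) ^ (β - 1) ≤ 2 ^ (β - 1) * ((m * y) ^ (β - 1) + q ^ (β - 1)) := by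
        rcases le_total (m * y) q with h | h
        · calc (m * y + q) ^ (β - 1) ≤ (2 * q) ^ (β - 1) := by gcongr; linarith
            _ = 2 ^ (β - 1) * q ^ (β - 1) := Real.mul_rpow (by norm_num) hq.le
            _ ≤ _ := by gcongr; exact le_add_of_nonneg_left (by positivity)
        · calc (m * y + q) ^ (β - 1) ≤ (2 * (m * y)) ^ (β - 1) := by gcongr; linarith
            _ = 2 ^ (β - 1) * (m * y) ^ (β - 1) := Real.mul_rpow (by norm_num) hx.le
            _ ≤ _ := by gcongr; exact le_add_of_nonneg_right (by positivity)
      have h4 : q * q ^ (β - 1) = q ^ β := by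
        rw [← Real.rpow_one_add' hq.le (by linarith)]; congr 1; ring
      have h5 : q * (m * y) ^ (β - 1) ≤ T := by
        have := rpow_mul_rpow_le_add (a := 1) (b := β - 1) hq.le hm (by norm_num) (by linarith)
          (add_sub_cancel 1 β)
        rw [Real.mul_rpow hm hy.le, ← mul_assoc, hTdef, abs_of_pos hq, abs_of_pos hy]
        rw [Real.rpow_one] at this
        have h6 : 0 ≤ y ^ (β - 1) := by positivity
        have h7 : 0 ≤ q ^ β + m ^ β := by positivity
        nlinarith [mul_le_mul_of_nonneg_right this h6]
      rw [abs_of_pos hq] at hT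
      have h8 : q * (m * y + q) ^ (β - 1) ≤ 2 ^ (β - 1) * (2 * T) := by
        calc q * (m * y + q) ^ (β - 1)
            ≤ q * (2 ^ (β - 1) * ((m * y) ^ (β - 1) + q ^ (β - 1))) := by gcongr
          _ = 2 ^ (β - 1) * (q * (m * y) ^ (β - 1) + q * q ^ (β - 1)) := by ring
          _ ≤ _ := by rw [h4]; gcongr; linarith
      have h9 := mul_le_mul_of_nonneg_left h8 hβ.le
      linarith

/-! ### Moments of order below `β`. -/

theorem rpow_lt_convex_combination {t x : ℝ} (ht0 : 0 < t) (ht1 : t < 1) (hx : 0 ≤ x)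
    (hx1 : x ≠ 1) : x ^ t < (1 - t) + t * x := by
  have := rpow_one_add_lt_one_add_mul_self (s := x - 1) (by linarith) (sub_ne_zero.2 hx1) ht0 ht1
  rw [add_sub_cancel] at this
  linarith

theorem rpow_le_convex_combination {t x : ℝ} (ht0 : 0 < t) (ht1 : t < 1) (hx : 0 ≤ x) :
    x ^ t ≤ (1 - t) + t * x := by
  rcases eq_or_ne x 1 with rfl | h
  · simp
  · exact (rpow_lt_convex_combination ht0 ht1 hx h).le

/-- Strict Jensen for the concave power `t = θ / β`, through the tangent line at `1`. -/
theorem lintegral_rpow_lt_one {α : Type*} [MeasurableSpace α] {ν : Measure α}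
    [IsProbabilityMeasure ν] {f : α → ℝ} (hf : Measurable f) (hpos : ∀ᵐ z ∂ν, 0 < f z)
    (hne : ¬ ∀ᵐ z ∂ν, f z = 1) {β θ : ℝ} (hθ : 0 < θ) (hθβ : θ < β)
    (h1 : ∫⁻ z, ENNReal.ofReal (f z ^ β) ∂ν = 1) :
    ∫⁻ z, ENNReal.ofReal (f z ^ θ) ∂ν < 1 := by
  have hβ : 0 < β := hθ.trans hθβ
  set t := θ / β with ht
  have ht0 : 0 < t := by positivity
  have ht1 : t < 1 := (div_lt_one hβ).2 hθβ
  have hpow : ∀ z, 0 < f z → f z ^ θ = (f z ^ β) ^ t := fun z hz => by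
    rw [← Real.rpow_mul hz.le, ht, mul_div_cancel₀ _ hβ.ne']
  have htot : ∫⁻ z, ENNReal.ofReal ((1 - t) + t * f z ^ β) ∂ν = 1 := by
    calc ∫⁻ z, ENNReal.ofReal ((1 - t) + t * f z ^ β) ∂ν
        = ∫⁻ z, (ENNReal.ofReal (1 - t) + ENNReal.ofReal t * ENNReal.ofReal (f z ^ β)) ∂ν := by
          refine lintegral_congr_ae (hpos.mono fun z hz => ?_)
          simp only
          rw [ENNReal.ofReal_add (by linarith) (by positivity), ENNReal.ofReal_mul ht0.le]
      _ = 1 := by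
          rw [lintegral_add_left measurable_const, lintegral_const_mul' _ _ ENNReal.ofReal_ne_top,
            h1, lintegral_const, measure_univ, mul_one, mul_one,
            ← ENNReal.ofReal_add (by linarith) ht0.le]
          simp
  rw [← htot]
  have hle : ∀ᵐ z ∂ν, ENNReal.ofReal (f z ^ θ) ≤ ENNReal.ofReal ((1 - t) + t * f z ^ β) := by
    filter_upwards [hpos] with z hz
    rw [hpow z hz]
    exact ENNReal.ofReal_le_ofReal (rpow_le_convex_combination ht0 ht1 (by positivity))
  refine lintegral_strict_mono_of_ae_le_of_frequently_ae_lt ?_ ?_ hle ?_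
  · fun_prop
  · exact ((lintegral_mono_ae hle).trans_lt (htot.trans_lt ENNReal.one_lt_top)).ne
  · intro hcon
    refine hne ?_
    filter_upwards [hcon, hpos] with z hz hz0
    by_contra h
    apply hz
    have h2 : f z ^ β ≠ 1 := fun h3 => h (by
      have := congrArg (· ^ β⁻¹) h3
      simpa [Real.rpow_rpow_inv hz0.le hβ.ne'] using this)
    have h3 := rpow_lt_convex_combination ht0 ht1 (by positivity) h2
    rw [hpow z hz0]
    exact ((ENNReal.ofReal_lt_ofReal_iff ((Real.rpow_nonneg (Real.rpow_nonneg hz0.le _) _).trans_lt h3)).2 h3).ne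

/-- `μ` is stationary for the random affine map `y ↦ q + m * y` with `(m, q)` of law `ν`. -/
def AffineStationary (μ : Measure ℝ) (ν : Measure (ℝ × ℝ)) : Prop :=
  ∀ g : ℝ → ℝ≥0∞, Measurable g → ∫⁻ y, g y ∂μ = ∫⁻ y, ∫⁻ z, g (z.2 + z.1 * y) ∂ν ∂μ

/-- Geometric drift bounds the stationary integral of a Lyapunov function. -/
theorem AffineStationary.lintegral_le_of_drift {μ : Measure ℝ} {ν : Measure (ℝ × ℝ)}
    [IsProbabilityMeasure μ] [IsProbabilityMeasure ν] (h : AffineStationary μ ν)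
    {V : ℝ → ℝ≥0∞} (hV : Measurable V) (hVtop : ∀ y, V y ≠ ∞) {c ρ : ℝ≥0∞} (hρ : ρ < 1)
    (hdrift : ∀ y, ∫⁻ z, V (z.2 + z.1 * y) ∂ν ≤ c + ρ * V y) :
    ∫⁻ y, V y ∂μ ≤ c * (1 - ρ)⁻¹ := by
  -- `V` is not known to be integrable. Truncating at `K` keeps the integrals finite, so the drift
  -- can be iterated and the term `ρ ^ n * V` removed by dominated convergence before `K` grows.
  have hstep : ∀ K a b : ℝ≥0∞,
      ∫⁻ y, min K (a + b * V y) ∂μ ≤ ∫⁻ y, min K (a + b * c + b * ρ * V y) ∂μ := by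
    intro K a b
    rw [h _ (by fun_prop)]
    refine lintegral_mono fun y => le_min ?_ ?_
    · calc ∫⁻ z, min K (a + b * V (z.2 + z.1 * y)) ∂ν ≤ ∫⁻ _, K ∂ν :=
            lintegral_mono fun z => min_le_left _ _
        _ = K := by simp
    · calc ∫⁻ z, min K (a + b * V (z.2 + z.1 * y)) ∂ν ≤ ∫⁻ z, (a + b * V (z.2 + z.1 * y)) ∂ν :=
            lintegral_mono fun z => min_le_right _ _
        _ = a + b * ∫⁻ z, V (z.2 + z.1 * y) ∂ν := by
            rw [lintegral_add_left measurable_const, lintegral_const_mul _ (by fun_prop)]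
            simp
        _ ≤ a + b * (c + ρ * V y) := by gcongr; exact hdrift y
        _ = _ := by ring
  have hiter : ∀ (K : ℝ≥0∞) (n : ℕ), ∫⁻ y, min K (V y) ∂μ ≤
      ∫⁻ y, min K (c * ∑ i ∈ Finset.range n, ρ ^ i + ρ ^ n * V y) ∂μ := by
    intro K n
    induction n with
    | zero => simp
    | succ n ih =>
      refine ih.trans ((hstep K _ _).trans_eq ?_)
      congr with y
      rw [Finset.sum_range_succ, pow_succ]
      ring_nf
  have hbound : ∀ (K : ℝ≥0∞) (n : ℕ), ∫⁻ y, min K (V y) ∂μ ≤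
      ∫⁻ y, min K (c * (1 - ρ)⁻¹ + ρ ^ n * V y) ∂μ := by
    intro K n
    refine (hiter K n).trans (lintegral_mono fun y => ?_)
    gcongr
    rw [← ENNReal.tsum_geometric]
    exact ENNReal.sum_le_tsum _
  have hK : ∀ K : ℕ, ∫⁻ y, min (K : ℝ≥0∞) (V y) ∂μ ≤ c * (1 - ρ)⁻¹ := by
    intro K
    have hlim : Tendsto (fun n : ℕ => ∫⁻ y, min (K : ℝ≥0∞) (c * (1 - ρ)⁻¹ + ρ ^ n * V y) ∂μ)
        atTop (nhds (∫⁻ _, min (K : ℝ≥0∞) (c * (1 - ρ)⁻¹ ) ∂μ)) := by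
      refine tendsto_lintegral_of_dominated_convergence (fun _ => K) (fun n => by fun_prop)
        (fun n => Eventually.of_forall fun y => min_le_left _ _) (by simp)
        (Eventually.of_forall fun y => ?_)
      refine Tendsto.min tendsto_const_nhds ?_
      have := ENNReal.Tendsto.mul_const (b := V y)
        (ENNReal.tendsto_pow_atTop_nhds_zero_of_lt_one hρ) (Or.inr (hVtop y))
      simpa using tendsto_const_nhds.add this
    refine (ge_of_tendsto' hlim (hbound K)).trans ?_
    simp
  have hsup : ∫⁻ y, V y ∂μ = ⨆ K : ℕ, ∫⁻ y, min (K : ℝ≥0∞) (V y) ∂μ := by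
    rw [← lintegral_iSup (fun K => by fun_prop)]
    · refine lintegral_congr fun y => le_antisymm ?_ (iSup_le fun K => min_le_right _ _)
      obtain ⟨K, hK⟩ := ENNReal.exists_nat_gt (hVtop y)
      exact le_iSup_of_le K (le_min hK.le le_rfl)
    · intro K L hKL y
      exact min_le_min_right _ (by exact_mod_cast hKL)
  rw [hsup]
  exact iSup_le hK

theorem AffineStationary.lintegral_rpow_lt_top {μ : Measure ℝ} {ν : Measure (ℝ × ℝ)}
    [IsProbabilityMeasure μ] [IsProbabilityMeasure ν] (h : AffineStationary μ ν)
    (hpos : ∀ᵐ z ∂ν, 0 < z.1) {θ : ℝ} (hθ : 0 < θ)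
    (hM : ∫⁻ z, ENNReal.ofReal (z.1 ^ θ) ∂ν < 1)
    (hQ : ∫⁻ z, ENNReal.ofReal (|z.2| ^ θ) ∂ν ≠ ∞) :
    ∫⁻ y, ENNReal.ofReal (|y| ^ θ) ∂μ ≠ ∞ := by
  set ρ := ∫⁻ z, ENNReal.ofReal (z.1 ^ θ) ∂ν with hρ
  obtain ⟨ε, hε, hερ⟩ : ∃ ε : ℝ, 0 < ε ∧ ENNReal.ofReal (1 + ε) * ρ < 1 := by
    have hlim : Tendsto (fun ε : ℝ => ENNReal.ofReal (1 + ε) * ρ) (nhdsWithin 0 (Set.Ioi 0))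
        (nhds (ENNReal.ofReal (1 + 0) * ρ)) := by
      refine ENNReal.Tendsto.mul_const ?_ (Or.inr (hM.trans ENNReal.one_lt_top).ne)
      refine (ENNReal.continuous_ofReal.comp (continuous_const.add continuous_id)).continuousAt.mono_left
        nhdsWithin_le_nhds
    have := hlim.eventually_lt_const (u := 1) (by simpa using hM)
    obtain ⟨ε, h1, h2⟩ := (this.and self_mem_nhdsWithin).exists
    exact ⟨ε, h2, h1⟩
  obtain ⟨C, hC, hbd⟩ := rpow_abs_add_le hθ hε
  have hmain := h.lintegral_le_of_drift (V := fun y => ENNReal.ofReal (|y| ^ θ)) (by fun_prop)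
    (fun y => ENNReal.ofReal_ne_top) (c := ENNReal.ofReal C * ∫⁻ z, ENNReal.ofReal (|z.2| ^ θ) ∂ν)
    hερ ?_
  · refine ne_top_of_le_ne_top ?_ hmain
    exact ENNReal.mul_ne_top (ENNReal.mul_ne_top ENNReal.ofReal_ne_top hQ)
      (ENNReal.inv_ne_top.2 (tsub_pos_of_lt hερ).ne')
  · intro y
    calc ∫⁻ z, ENNReal.ofReal (|z.2 + z.1 * y| ^ θ) ∂ν
        ≤ ∫⁻ z, (ENNReal.ofReal C * ENNReal.ofReal (|z.2| ^ θ) +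
            ENNReal.ofReal (1 + ε) * ENNReal.ofReal (|y| ^ θ) * ENNReal.ofReal (z.1 ^ θ)) ∂ν := by
          refine lintegral_mono_ae (hpos.mono fun z hz => ?_)
          rw [← ENNReal.ofReal_mul hC, ← ENNReal.ofReal_mul (by linarith),
            ← ENNReal.ofReal_mul (by positivity), ← ENNReal.ofReal_add (by positivity)
            (by positivity)]
          refine ENNReal.ofReal_le_ofReal ((hbd _ _).trans_eq ?_)
          rw [abs_mul, abs_of_pos hz, Real.mul_rpow hz.le (abs_nonneg y)]
          ring
      _ = _ := by
          rw [lintegral_add_left (by fun_prop), lintegral_const_mul _ (by fun_prop),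
            lintegral_const_mul _ (by fun_prop), ← hρ]
          ring

/-! ### Lattice laws and geometric slices. -/

theorem lintegral_comp_of_lattice {α : Type*} [MeasurableSpace α] {ν : Measure α} {f : α → ℝ}
    (hf : Measurable f) {d : ℝ} (hd : 0 < d) (hlat : ∀ᵐ z ∂ν, ∃ k : ℤ, f z = Real.exp (k * d))
    (g : ℝ → ℝ≥0∞) :
    ∫⁻ z, g (f z) ∂ν = ∑' k : ℤ, ν {z | f z = Real.exp (k * d)} * g (Real.exp (k * d)) := by
  have hms : ∀ k : ℤ, MeasurableSet {z | f z = Real.exp (k * d)} := fun k =>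
    hf (measurableSet_singleton _)
  calc ∫⁻ z, g (f z) ∂ν
      = ∫⁻ z, ∑' k : ℤ, {z | f z = Real.exp (k * d)}.indicator
          (fun _ => g (Real.exp (k * d))) z ∂ν := by
        refine lintegral_congr_ae (hlat.mono fun z ⟨k, hk⟩ => ?_)
        simp only
        rw [tsum_eq_single k, Set.indicator_of_mem (by exact hk), hk]
        intro j hj
        refine Set.indicator_of_notMem (fun hjz => hj ?_) _
        have h1 : (j : ℝ) * d = k * d := Real.exp_injective (hjz.symm.trans hk)
        exact_mod_cast mul_right_cancel₀ hd.ne' h1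
    _ = _ := by
        rw [lintegral_tsum fun k => (measurable_const.indicator (hms k)).aemeasurable]
        refine tsum_congr fun k => ?_
        rw [lintegral_indicator_const (hms k), mul_comm]

theorem ENNReal.ofReal_zpow {x : ℝ} (hx : 0 < x) (n : ℤ) :
    ENNReal.ofReal (x ^ n) = ENNReal.ofReal x ^ n := by
  rw [← Real.rpow_intCast, ← ENNReal.ofReal_rpow_of_pos hx, ENNReal.rpow_intCast]

theorem Real.exp_zpow (x : ℝ) (n : ℤ) : Real.exp x ^ n = Real.exp (n * x) := by
  rw [← Real.rpow_intCast, ← Real.exp_mul, mul_comm]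

/-- The length of `[L ^ n, L ^ (n + 1)) ∩ (-∞, x)`. -/
noncomputable def geomSlice (L : ℝ) (n : ℤ) (x : ℝ) : ℝ≥0∞ :=
  ENNReal.ofReal (min (L ^ (n + 1)) x - L ^ n)

theorem measurable_geomSlice (L : ℝ) (n : ℤ) : Measurable (geomSlice L n) := by
  unfold geomSlice; fun_prop

theorem geomSlice_zpow_mul {L : ℝ} (hL : 0 < L) (n k : ℤ) (x : ℝ) :
    geomSlice L n (L ^ k * x) = ENNReal.ofReal (L ^ k) * geomSlice L (n - k) x := by
  unfold geomSlice
  have hk : 0 < L ^ k := zpow_pos hL k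
  rw [← ENNReal.ofReal_mul hk.le, mul_sub, mul_min_of_nonneg _ _ hk.le, ← zpow_add₀ hL.ne',
    ← zpow_add₀ hL.ne']
  congr 4 <;> ring

theorem geomSlice_eq_volume (L : ℝ) (n : ℤ) (x : ℝ) :
    geomSlice L n x = volume (Set.Ico (L ^ n) (L ^ (n + 1)) ∩ Set.Iio x) := by
  rw [Set.Ico_inter_Iio, Real.volume_Ico, geomSlice]

/-- The slices are disjoint, and only points of `[x, y)` contribute; truncated subtraction makes
every term vanish when `y ≤ x`. -/
theorem tsum_geomSlice_sub_le {L : ℝ} (hL : 1 ≤ L) (x y : ℝ) :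
    ∑' n, (geomSlice L n y - geomSlice L n x) ≤ ENNReal.ofReal (y - x) := by
  have hle : ∀ n, geomSlice L n y - geomSlice L n x ≤
      volume (Set.Ico (L ^ n) (L ^ (n + 1)) ∩ Set.Ico x y) := by
    intro n
    rw [tsub_le_iff_left, geomSlice_eq_volume, geomSlice_eq_volume]
    refine (measure_mono ?_).trans (measure_union_le _ _)
    rintro t ⟨h1, h2⟩
    rcases lt_or_ge t x with h | h
    · exact Or.inl ⟨h1, h⟩
    · exact Or.inr ⟨h1, h, h2⟩
  have hdisj : Pairwise (Function.onFun Disjoint fun n : ℤ => Set.Ico (L ^ n) (L ^ (n + 1))) :=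
    (zpow_right_mono₀ hL).pairwise_disjoint_on_Ico_succ
  calc ∑' n, (geomSlice L n y - geomSlice L n x)
      ≤ ∑' n : ℤ, volume (Set.Ico (L ^ n) (L ^ (n + 1)) ∩ Set.Ico x y) :=
        ENNReal.tsum_le_tsum hle
    _ = volume (⋃ n : ℤ, Set.Ico (L ^ n) (L ^ (n + 1)) ∩ Set.Ico x y) := by
        rw [measure_iUnion]
        · exact fun i j hij => (hdisj hij).mono Set.inter_subset_left Set.inter_subset_left
        · exact fun n => measurableSet_Ico.inter measurableSet_Ico
    _ ≤ volume (Set.Ico x y) := measure_mono (Set.iUnion_subset fun n => Set.inter_subset_right)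
    _ = _ := Real.volume_Ico

/-- A Markov-type bound: the slice is empty unless `|y| > exp (n * d)`, and then `L ^ n` is at most
`exp ((β - θ) * d) ^ n * |y| ^ θ`. -/
theorem geomSlice_posPart_rpow_le {β θ d : ℝ} (hθ : 0 < θ) (hθβ : θ < β) (n : ℤ)
    (y : ℝ) : geomSlice (Real.exp (β * d)) n (max y 0 ^ β) ≤
      ENNReal.ofReal (Real.exp (β * d)) * ENNReal.ofReal (|y| ^ θ) *
        ENNReal.ofReal (Real.exp ((β - θ) * d)) ^ n := by
  have hβ : 0 < β := hθ.trans hθβ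
  set L := Real.exp (β * d) with hL
  have hL0 : 0 < L := Real.exp_pos _
  rw [← ENNReal.ofReal_zpow (Real.exp_pos _), ← ENNReal.ofReal_mul hL0.le,
    ← ENNReal.ofReal_mul (by positivity)]
  refine ENNReal.ofReal_le_ofReal ?_
  rcases le_or_gt (max y 0 ^ β) (L ^ n) with h | h
  · have : min (L ^ (n + 1)) (max y 0 ^ β) - L ^ n ≤ 0 := by
      linarith [min_le_right (L ^ (n + 1)) (max y 0 ^ β)]
    exact this.trans (by positivity)
  · have hLn : L ^ n = Real.exp (n * d) ^ β := by
      rw [hL, Real.exp_zpow, ← Real.exp_mul]; congr 1; ring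
    rw [hLn] at h
    have h1 : Real.exp (n * d) < |y| := by
      have := (Real.rpow_lt_rpow_iff (Real.exp_pos _).le (le_max_right _ _) hβ).1 h
      exact this.trans_le (max_le (le_abs_self y) (abs_nonneg y))
    have h2 : Real.exp (n * d) ^ β = Real.exp ((β - θ) * d) ^ n * Real.exp (n * d) ^ θ := by
      rw [Real.exp_zpow, ← Real.exp_mul, ← Real.exp_mul, ← Real.exp_add]; congr 1; ring
    calc min (L ^ (n + 1)) (max y 0 ^ β) - L ^ n ≤ L ^ (n + 1) := by
          linarith [min_le_left (L ^ (n + 1)) (max y 0 ^ β), zpow_pos hL0 n]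
      _ = L * (Real.exp ((β - θ) * d) ^ n * Real.exp (n * d) ^ θ) := by
          rw [zpow_add_one₀ hL0.ne', hLn, h2]; ring
      _ ≤ L * (Real.exp ((β - θ) * d) ^ n * |y| ^ θ) := by gcongr
      _ = _ := by ring

theorem exists_tail_bound_of_geomSlice {μ : Measure ℝ} {β d : ℝ} (hβ : 0 < β) (hd : 0 < d)
    {B : ℝ≥0∞} (hB : B ≠ ∞)
    (h : ∀ n, ∫⁻ y, geomSlice (Real.exp (β * d)) n (max y 0 ^ β) ∂μ ≤ B) :
    ∃ C : ℝ≥0∞, C ≠ ∞ ∧ ∀ u : ℝ, 0 < u → ENNReal.ofReal (u ^ β) * μ (Set.Ioi u) ≤ C := by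
  set L := Real.exp (β * d) with hL
  have hL1 : 1 < L := Real.one_lt_exp_iff.2 (by positivity)
  have hL0 : 0 < L := by linarith
  refine ⟨ENNReal.ofReal (L ^ 2 / (L - 1)) * B, ENNReal.mul_ne_top ENNReal.ofReal_ne_top hB,
    fun u hu => ?_⟩
  obtain ⟨n, hn1, hn2⟩ := exists_mem_Ico_zpow (x := u ^ β) (Real.rpow_pos_of_pos hu β) hL1
  -- The slice one below the level of `u ^ β` is completely filled as soon as `y > u`.
  have hslice : ENNReal.ofReal (L ^ n - L ^ (n - 1)) * μ (Set.Ioi u) ≤ B := by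
    refine le_trans ?_ (h (n - 1))
    rw [← lintegral_indicator_const measurableSet_Ioi]
    refine lintegral_mono fun y => ?_
    by_cases hy : u < y
    · rw [Set.indicator_of_mem (by exact hy), geomSlice, sub_add_cancel, min_eq_left]
      refine hn1.trans ?_
      gcongr
      exact le_max_of_le_left hy.le
    · rw [Set.indicator_of_notMem (by exact hy)]
      exact zero_le
  have hfac : L ^ (n + 1) = L ^ 2 / (L - 1) * (L ^ n - L ^ (n - 1)) := by
    rw [zpow_add_one₀ hL0.ne', zpow_sub_one₀ hL0.ne']
    have : L - 1 ≠ 0 := by linarith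
    field_simp
  calc ENNReal.ofReal (u ^ β) * μ (Set.Ioi u) ≤ ENNReal.ofReal (L ^ (n + 1)) * μ (Set.Ioi u) := by
        gcongr
    _ = ENNReal.ofReal (L ^ 2 / (L - 1)) *
          (ENNReal.ofReal (L ^ n - L ^ (n - 1)) * μ (Set.Ioi u)) := by
        rw [hfac, ENNReal.ofReal_mul (div_nonneg (by positivity) (by linarith)), mul_assoc]
    _ ≤ _ := by gcongr

/-! ### The renewal inequality for the stationary law, and the tail bound. -/

theorem AffineStationary.exists_tail_bound {μ : Measure ℝ} {ν : Measure (ℝ × ℝ)}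
    [IsProbabilityMeasure μ] [IsProbabilityMeasure ν] (h : AffineStationary μ ν)
    (hpos : ∀ᵐ z ∂ν, 0 < z.1) (hne : ¬ ∀ᵐ z ∂ν, z.1 = 1) {β : ℝ} (hβ : 0 < β)
    (hM : ∫⁻ z, ENNReal.ofReal (z.1 ^ β) ∂ν = 1)
    (hQ : ∫⁻ z, ENNReal.ofReal (|z.2| ^ β) ∂ν ≠ ∞) {d : ℝ} (hd : 0 < d)
    (hlat : ∀ᵐ z ∂ν, ∃ k : ℤ, z.1 = Real.exp (k * d)) :
    ∃ C : ℝ≥0∞, C ≠ ∞ ∧ ∀ u : ℝ, 0 < u → ENNReal.ofReal (u ^ β) * μ (Set.Ioi u) ≤ C := by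
  obtain ⟨C, θ, hC, hθ, hθβ, hinc⟩ := exists_posPart_rpow_add_le hβ
  set L := Real.exp (β * d) with hL
  have hL0 : 0 < L := Real.exp_pos _
  have hL1 : 1 ≤ L := Real.one_le_exp (by positivity)
  have hMθ := lintegral_rpow_lt_one measurable_fst hpos hne hθ hθβ hM
  have hQθ : ∫⁻ z, ENNReal.ofReal (|z.2| ^ θ) ∂ν ≠ ∞ := by
    refine ne_top_of_le_ne_top (b := ∫⁻ z, (1 + ENNReal.ofReal (|z.2| ^ β)) ∂ν) ?_ ?_
    · rw [lintegral_add_left measurable_const]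
      simpa using hQ
    · refine lintegral_mono fun z => ?_
      rw [← ENNReal.ofReal_one, ← ENNReal.ofReal_add zero_le_one (by positivity)]
      refine ENNReal.ofReal_le_ofReal ?_
      have := rpow_mul_rpow_le_add (abs_nonneg z.2) zero_le_one hθ.le (sub_nonneg.2 hθβ.le)
        (add_sub_cancel θ β)
      simpa [add_comm] using this
  have hYθ := h.lintegral_rpow_lt_top hpos hθ hMθ hQθ
  set φ : ℤ → ℝ → ℝ≥0∞ := fun n y => geomSlice L n (max y 0 ^ β) with hφ
  have hφm : ∀ n, Measurable (φ n) := fun n => (measurable_geomSlice L n).comp (by fun_prop)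
  set q : ℤ → ℝ≥0∞ := fun k => ν {z | z.1 = Real.exp (k * d)} with hq
  set p : ℤ → ℝ≥0∞ := fun k => q k * ENNReal.ofReal (L ^ k) with hp
  -- Truncated subtraction discards negative increments, which only help in an upper bound.
  set G : ℤ → ℝ≥0∞ := fun n => ∫⁻ y, ∫⁻ z, (φ n (z.2 + z.1 * y) - φ n (z.1 * y)) ∂ν ∂μ with hG
  have hLk : ∀ k : ℤ, L ^ k = Real.exp (k * d) ^ β := fun k => by
    rw [hL, Real.exp_zpow, ← Real.exp_mul]; congr 1; ring
  have hpsum : ∑' k, p k = 1 := by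
    rw [← hM, lintegral_comp_of_lattice measurable_fst hd hlat fun x => ENNReal.ofReal (x ^ β)]
    simp only [hp, hLk, hq]
  have hscale : ∀ n (k : ℤ) y,
      φ n (Real.exp (k * d) * y) = ENNReal.ofReal (L ^ k) * φ (n - k) y := by
    intro n k y
    have h1 : max (Real.exp (k * d) * y) 0 ^ β = L ^ k * max y 0 ^ β := by
      rw [hLk, ← Real.mul_rpow (Real.exp_pos _).le (le_max_right _ _),
        mul_max_of_nonneg _ _ (Real.exp_pos _).le, mul_zero]
    simp only [hφ, h1, geomSlice_zpow_mul hL0]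
  have hconv : ∀ n, ∫⁻ y, ∫⁻ z, φ n (z.1 * y) ∂ν ∂μ =
      intConv p (fun n => ∫⁻ y, φ n y ∂μ) n := by
    intro n
    have h1 : ∀ y, ∫⁻ z, φ n (z.1 * y) ∂ν = ∑' k, p k * φ (n - k) y := by
      intro y
      rw [lintegral_comp_of_lattice measurable_fst hd hlat fun x => φ n (x * y)]
      refine tsum_congr fun k => ?_
      rw [hscale, ← mul_assoc]
    simp only [h1, intConv]
    rw [lintegral_tsum fun k => ((hφm _).const_mul _).aemeasurable]
    exact tsum_congr fun k => lintegral_const_mul _ (hφm _)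
  have hGsum : ∑' n, G n ≠ ∞ := by
    have hm : ∀ n, Measurable fun w : ℝ × (ℝ × ℝ) =>
        φ n (w.2.2 + w.2.1 * w.1) - φ n (w.2.1 * w.1) := fun n =>
      ((hφm n).comp (show Measurable fun w : ℝ × (ℝ × ℝ) => w.2.2 + w.2.1 * w.1 by fun_prop)).sub
        ((hφm n).comp (show Measurable fun w : ℝ × (ℝ × ℝ) => w.2.1 * w.1 by fun_prop))
    have hmz : ∀ n y, Measurable fun z : ℝ × ℝ => φ n (z.2 + z.1 * y) - φ n (z.1 * y) :=
      fun n y => ((hφm n).comp (show Measurable fun z : ℝ × ℝ => z.2 + z.1 * y by fun_prop)).sub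
        ((hφm n).comp (show Measurable fun z : ℝ × ℝ => z.1 * y by fun_prop))
    have hmy : ∀ n, Measurable fun y => ∫⁻ z, (φ n (z.2 + z.1 * y) - φ n (z.1 * y)) ∂ν :=
      fun n => Measurable.lintegral_prod_right (hm n)
    have h1 : ∑' n, G n = ∫⁻ y, ∫⁻ z, ∑' n, (φ n (z.2 + z.1 * y) - φ n (z.1 * y)) ∂ν ∂μ :=
      (lintegral_tsum fun n => (hmy n).aemeasurable).symm.trans
        (lintegral_congr fun y => (lintegral_tsum fun n => (hmz n y).aemeasurable).symm)
    rw [h1]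
    refine ne_top_of_le_ne_top (b := ∫⁻ y, ∫⁻ z, (ENNReal.ofReal C *
      (1 + ENNReal.ofReal (|y| ^ θ))) *
        (ENNReal.ofReal (|z.2| ^ β) + ENNReal.ofReal (z.1 ^ β)) ∂ν ∂μ) ?_ ?_
    · have h2 : ∀ y : ℝ, ∫⁻ z, (ENNReal.ofReal C * (1 + ENNReal.ofReal (|y| ^ θ))) *
          (ENNReal.ofReal (|z.2| ^ β) + ENNReal.ofReal (z.1 ^ β)) ∂ν =
          (1 + ENNReal.ofReal (|y| ^ θ)) *
            (ENNReal.ofReal C * (∫⁻ z, ENNReal.ofReal (|z.2| ^ β) ∂ν + 1)) := by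
        intro y
        rw [lintegral_const_mul _ (by fun_prop), lintegral_add_left (by fun_prop), hM]
        ring
      simp only [h2]
      rw [lintegral_mul_const _ (by fun_prop), lintegral_add_left measurable_const]
      refine ENNReal.mul_ne_top ?_ (ENNReal.mul_ne_top ENNReal.ofReal_ne_top ?_)
      · simpa using hYθ
      · simpa using hQ
    · refine lintegral_mono fun y => lintegral_mono_ae (hpos.mono fun z hz => ?_)
      refine (tsum_geomSlice_sub_le hL1 _ _).trans ?_
      rw [← ENNReal.ofReal_one, ← ENNReal.ofReal_add zero_le_one (by positivity),
        ← ENNReal.ofReal_add (by positivity) (by positivity), ← ENNReal.ofReal_mul hC,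
        ← ENNReal.ofReal_mul (by positivity)]
      refine ENNReal.ofReal_le_ofReal ?_
      linarith [hinc z.2 z.1 y hz.le]
  have hrec : ∀ n, ∫⁻ y, φ n y ∂μ ≤ intConv p (fun n => ∫⁻ y, φ n y ∂μ) n + G n := by
    intro n
    rw [h _ (hφm n), ← hconv, hG]
    have hm : Measurable fun w : ℝ × (ℝ × ℝ) => φ n (w.2.1 * w.1) := (hφm n).comp (by fun_prop)
    have hmy : Measurable fun y => ∫⁻ z, φ n (z.1 * y) ∂ν := Measurable.lintegral_prod_right hm
    rw [← lintegral_add_left hmy]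
    refine lintegral_mono fun y => ?_
    rw [← lintegral_add_left
      (show Measurable fun z : ℝ × ℝ => φ n (z.1 * y) from
        (hφm n).comp (show Measurable fun z : ℝ × ℝ => z.1 * y by fun_prop))]
    exact lintegral_mono fun z => le_add_tsub
  -- Tilting back by `c ^ (-k)` turns the weight `exp (β * k * d)` into `exp (θ * k * d)`.
  have hc : ∑' k, p k * ENNReal.ofReal (Real.exp ((β - θ) * d)) ^ (-k) =
      ∫⁻ z, ENNReal.ofReal (z.1 ^ θ) ∂ν := by
    rw [lintegral_comp_of_lattice measurable_fst hd hlat fun x => ENNReal.ofReal (x ^ θ)]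
    refine tsum_congr fun k => ?_
    rw [hp, mul_assoc, ← ENNReal.ofReal_zpow (Real.exp_pos _),
      ← ENNReal.ofReal_mul (by positivity)]
    congr 2
    rw [hL, Real.exp_zpow, Real.exp_zpow, ← Real.exp_mul, ← Real.exp_add]
    congr 1
    push_cast
    ring
  have hgrowth : ∀ n, ∫⁻ y, φ n y ∂μ ≤ (ENNReal.ofReal L * ∫⁻ y, ENNReal.ofReal (|y| ^ θ) ∂μ) *
      ENNReal.ofReal (Real.exp ((β - θ) * d)) ^ n := by
    intro n
    refine (lintegral_mono fun y => geomSlice_posPart_rpow_le hθ hθβ n y).trans_eq ?_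
    rw [lintegral_mul_const _ (by fun_prop), lintegral_const_mul _ (by fun_prop)]
  obtain ⟨B, hB, hbound⟩ := exists_bound_of_le_intConv_add hpsum hMθ (by simp [Real.exp_pos])
    ENNReal.ofReal_ne_top hc (ENNReal.mul_ne_top ENNReal.ofReal_ne_top hYθ) hgrowth hGsum hrec
  exact exists_tail_bound_of_geomSlice hβ hd hB hbound

theorem SolvesAffineEquation.affineStationary {Ω : Type*} [MeasurableSpace Ω] {P : Measure Ω}
    [IsProbabilityMeasure P] {M Q Y : Ω → ℝ} (hM : AEMeasurable M P) (hQ : AEMeasurable Q P)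
    (hY : AEMeasurable Y P) (h : SolvesAffineEquation P M Q Y) :
    AffineStationary (P.map Y) (P.map fun ω => (M ω, Q ω)) := by
  intro g hg
  have hMQ : AEMeasurable (fun ω => (M ω, Q ω)) P := hM.prodMk hQ
  have : IsProbabilityMeasure (P.map fun ω => (M ω, Q ω)) := Measure.isProbabilityMeasure_map hMQ
  have hm : Measurable fun w : ℝ × (ℝ × ℝ) => g (w.2.2 + w.2.1 * w.1) := hg.comp (by fun_prop)
  have hprod := (indepFun_iff_map_prod_eq_prod_map_map hY hMQ).1 h.indep
  rw [← lintegral_prod _ hm.aemeasurable, ← hprod, lintegral_map' hm.aemeasurable (hY.prodMk hMQ),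
    h.law_eq.map_eq, lintegral_map' hg.aemeasurable h.law_eq.aemeasurable_snd]

theorem mainTheorem7 {Ω : Type*} [MeasurableSpace Ω] (P : Measure Ω) [IsProbabilityMeasure P]
    (M Q Y : Ω → ℝ) (hM : AEMeasurable M P) (hQ : AEMeasurable Q P) (hY : AEMeasurable Y P)
    (hM_pos : ∀ᵐ ω ∂P, 0 < M ω)
    (hM_ne : ¬ ∀ᵐ ω ∂P, M ω = 1)
    (β : ℝ) (hβ : 0 < β)
    (hMβ : Integrable (fun ω => M ω ^ β) P ∧ ∫ ω, M ω ^ β ∂P = 1)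
    (hMlog : Integrable (fun ω => M ω ^ β * max (Real.log (M ω)) 0) P)
    (hQβ : Integrable (fun ω => |Q ω| ^ β) P)
    (d : ℝ) (hd : 0 < d)
    (hlattice : ∀ᵐ ω ∂P, ∃ k : ℤ, Real.log (M ω) = k * d)
    (hsol : SolvesAffineEquation P M Q Y) :
    limsup (fun u : ℝ => ENNReal.ofReal (u ^ β) * P {ω | u < Y ω}) atTop < ∞ := by
  have hMQ : AEMeasurable (fun ω => (M ω, Q ω)) P := hM.prodMk hQ
  have : IsProbabilityMeasure (P.map Y) := Measure.isProbabilityMeasure_map hY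
  have : IsProbabilityMeasure (P.map fun ω => (M ω, Q ω)) := Measure.isProbabilityMeasure_map hMQ
  have hint : ∫⁻ z, ENNReal.ofReal (z.1 ^ β) ∂(P.map fun ω => (M ω, Q ω)) = 1 := by
    rw [lintegral_map' (by fun_prop) hMQ, ← ofReal_integral_eq_lintegral_ofReal hMβ.1
      (hM_pos.mono fun ω h => (Real.rpow_pos_of_pos h β).le), hMβ.2, ENNReal.ofReal_one]
  have hintQ : ∫⁻ z, ENNReal.ofReal (|z.2| ^ β) ∂(P.map fun ω => (M ω, Q ω)) ≠ ∞ := by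
    rw [lintegral_map' (by fun_prop) hMQ]
    exact hQβ.lintegral_lt_top.ne
  have hlat : ∀ᵐ z ∂(P.map fun ω => (M ω, Q ω)), ∃ k : ℤ, z.1 = Real.exp (k * d) := by
    have hset : MeasurableSet {z : ℝ × ℝ | ∃ k : ℤ, z.1 = Real.exp (k * d)} := by
      rw [Set.ofPred_exists]
      exact MeasurableSet.iUnion fun k => measurable_fst (measurableSet_singleton _)
    refine (ae_map_iff hMQ hset).2 ?_
    filter_upwards [hlattice, hM_pos] with ω ⟨k, hk⟩ h0
    exact ⟨k, by rw [← hk, Real.exp_log h0]⟩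
  obtain ⟨C, hC, hbound⟩ := (hsol.affineStationary hM hQ hY).exists_tail_bound
    ((ae_map_iff hMQ (measurableSet_lt measurable_const measurable_fst)).2 hM_pos)
    (fun h => hM_ne (ae_of_ae_map hMQ h)) hβ hint hintQ hd hlat
  refine lt_of_le_of_lt (limsup_le_of_le (by isBoundedDefault) ?_) hC.lt_top
  filter_upwards [eventually_gt_atTop 0] with u hu
  have := hbound u hu
  rwa [Measure.map_apply_of_aemeasurable hY measurableSet_Ioi] at this
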